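/- Let $A\in\mathbb{R}^{n\times n}$ be symmetric positive definite with all eigenvalues in $[a,b]$, where $0<a<b$, let $p\ge 1$ and $0<\varepsilon\le 1$ be real, and let $\|A\|_p=\big(\sum_j\sigma_j(A)^p\big)^{1/p}$ be the Schatten $p$-norm, with $\sigma_j(A)$ the singular values of $A$. For an integer $N\ge 0$ let \[ \psi_N(x)=\sum_{j=0}^{N}c_j\,T_j\!\left(\frac{2}{b-a}x-\frac{b+a}{b-a}\right),\qquad c_j=\frac{2}{\pi}\int_0^{\pi}\left(\frac{b-a}{2}\cos\theta+\frac{b+a}{2}\right)^{p/2}\cos(j\theta)\,d\theta\quad(j\ge 1), \] with $c_0$ given by the same formula with an additional factor $\tfrac12$, be the degree-$N$ Chebyshev approximation of $x^{p/2}$ on $[a,b]$; here $T_j(\cos\theta)=\cos(j\theta)$. Put $\kappa=\sqrt{b/a}$, $q=p/2$, and suppose that \[ N\ \ge\ \frac{\log\left(\frac{4}{\varepsilon}(\kappa^2+1)^q(\kappa-1)\left(\kappa^p+\sqrt{\frac{\varepsilon}{2}+\kappa^{2p}}\right)\right)}{\log\left(\frac{\kappa+1}{\kappa-1}\right)}.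 \] Let $M\ge 1$, let $w_1,\dots,w_M$ be random vectors in $\mathbb{R}^n$ on a probability space whose $Mn$ entries are independent standard normal random variables, and let \[ Y_{M,N}=\left(\frac1M\sum_{j=1}^{M}w_j^{T}\,\psi_N(A)^2\,w_j\right)^{1/p}. \] Then: 1. $Y_{M,N}$ is integrable and \[ \big|\mathbb{E}\,Y_{M,N}-\|A\|_p\big|\le\left(1+\frac{\varepsilon}{2}\right)\|A\|_p\left(\frac{2}{M}\right)^{1/2}+\frac{\varepsilon}{2}\|A\|_p . \] 2. For every $\delta\in(0,1)$, if $M\ge 72\,\varepsilon^{-2}\ln(2/\delta)$, then $Y_{M,N}$ is an $(\varepsilon,\delta)$ estimator of $\|A\|_p$, that is, \[ \mathbb{P}\big(\,|Y_{M,N}-\|A\|_p|\le\varepsilon\,\|A\|_p\,\big)\ge 1-\delta . \] -/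

import Mathlib

open MeasureTheory ProbabilityTheory Polynomial

noncomputable section

/-- The Schatten `p`-norm of a real `m × n` matrix: the `ℓ^p` norm of its `min m n` singular
values (Mathlib numbers the singular values from `0`). -/
def schattenNorm {m n : ℕ} (p : ℝ) (A : Matrix (Fin m) (Fin n) ℝ) : ℝ :=
  (∑ j ∈ Finset.range (min m n), (Matrix.toEuclideanLin A).singularValues j ^ p) ^ (1 / p)

/-- The `j`-th Chebyshev coefficient of a function `g` on `[-1, 1]`:
`(2/π) ∫_0^π g(cos θ) cos(jθ) dθ`, with an additional factor `1/2` when `j = 0`. -/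
def chebyshevCoeff (g : ℝ → ℝ) (j : ℕ) : ℝ :=
  (if j = 0 then 1 / Real.pi else 2 / Real.pi) *
    ∫ θ in (0 : ℝ)..Real.pi, g (Real.cos θ) * Real.cos (j * θ)

/-- The degree `N` Chebyshev approximation (truncated Chebyshev series) of `g` on `[a, b]`,
with `[a, b]` identified with `[-1, 1]` through `x ↦ (2 / (b - a)) x - (b + a) / (b - a)`. -/
def chebyshevApprox (a b : ℝ) (g : ℝ → ℝ) (N : ℕ) : ℝ[X] :=
  ∑ j ∈ Finset.range (N + 1),
    C (chebyshevCoeff (fun t => g ((b - a) / 2 * t + (b + a) / 2)) j) *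
      (Chebyshev.T ℝ (j : ℤ)).comp (C (2 / (b - a)) * X - C ((b + a) / (b - a)))

/-- `ψ_N`: the degree `N` Chebyshev approximation of `x ↦ x ^ (p / 2)` on `[a, b]`. -/
def psiPoly (a b p : ℝ) (N : ℕ) : ℝ[X] :=
  chebyshevApprox a b (fun x => x ^ (p / 2)) N

/-- The matrix `φ_N(A) = ψ_N(A)^2`. -/
def phiMatrix {n : ℕ} (a b p : ℝ) (N : ℕ) (A : Matrix (Fin n) (Fin n) ℝ) :
    Matrix (Fin n) (Fin n) ℝ :=
  (aeval A (psiPoly a b p N)) ^ 2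

/-- The Chebyshev–Monte Carlo estimator
`Y_{M,N} = ((1/M) ∑_j w_jᵀ φ_N(A) w_j)^(1/p)` built from the sample vectors `w_1, …, w_M`. -/
def chebyshevMonteCarlo {n M : ℕ} (a b p : ℝ) (N : ℕ) (A : Matrix (Fin n) (Fin n) ℝ)
    (w : Fin M → Fin n → ℝ) : ℝ :=
  ((1 / (M : ℝ)) * ∑ j, w j ⬝ᵥ (phiMatrix a b p N A).mulVec (w j)) ^ (1 / p)

/-- The lower bound on the Chebyshev degree, with `κ = √(b/a)` and `q = p/2`. -/
def chebyshevDegreeBound (a b p ε : ℝ) : ℝ :=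
  let κ := Real.sqrt (b / a)
  Real.log (4 / ε * (κ ^ 2 + 1) ^ (p / 2) * (κ - 1) *
      (κ ^ p + Real.sqrt (ε / 2 + κ ^ (2 * p)))) /
    Real.log ((κ + 1) / (κ - 1))

/-- The random variable `Y` is an `(ε, δ)` estimator of the number `t`: with probability at
least `1 - δ` its relative error is at most `ε`. -/
def IsEpsDeltaEstimator {Ω : Type*} [MeasurableSpace Ω] (μ : Measure Ω) (ε δ : ℝ)
    (Y : Ω → ℝ) (t : ℝ) : Prop :=
  1 - δ ≤ μ.real {ω | |Y ω - t| ≤ ε * |t|}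

end

/-! In an eigenbasis of `A` the quadratic forms become weighted sums of squares of standard normals,
so the estimator is `(S * Z) ^ (1 / p)`. Here `S` is the sum of `ψ_N(λ_i)^2`, and `Z` is a convex
combination of `M * n` independent squares with weights at most `1 / M`
(`exists_chebyshevMonteCarlo_eq`). Two relative errors remain, and both pass through the `1 / p`-th
power because `|u ^ r - 1| ≤ |u - 1|` for `0 < r ≤ 1` (`abs_rpow_sub_one_le`).

Deterministic error: `x ^ (p / 2)` is holomorphic inside the ellipse with foci `a`, `b` through `0`,
whose parameter is `ρ = (κ + 1) / (κ - 1)`. Shifting the contour bounds its Chebyshev coefficients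
by a multiple of `ρ⁻¹ ^ n`. Summing the tail, the degree bound gives relative error `ε / 8` for
`ψ_N`, hence `ε / 2` for `ψ_N ^ 2` (`abs_sq_eval_psiPoly_sub_le`) and for `S` against `‖A‖_p ^ p`.

Random error: `Z` has mean `1` and variance at most `2 / M`, which gives the bias bound. A Chernoff
estimate gives `2 exp(-M η ^ 2 / 8)` for a deviation of `η`, applied with `η = ε / 3`. -/

/-! ### Chebyshev series as Fourier series on the circle -/

/-- The Fourier integral of an even function over a period reduces to a cosine integral. -/
lemma integral_exp_mul_comp_cos (g : ℝ → ℝ) (hg : Continuous g) (n : ℤ) :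
    (∫ θ in (-Real.pi)..Real.pi, Complex.exp (-(n * θ * Complex.I)) * (g (Real.cos θ) : ℂ)) =
      ((2 * ∫ θ in (0 : ℝ)..Real.pi, g (Real.cos θ) * Real.cos (n * θ) : ℝ) : ℂ) := by
  set f : ℝ → ℂ := fun θ => Complex.exp (-(n * θ * Complex.I)) * (g (Real.cos θ) : ℂ) with hf
  have hfc : Continuous f := by
    simp only [hf]
    fun_prop
  have h1 : (∫ θ in (-Real.pi)..0, f θ) = ∫ θ in (0 : ℝ)..Real.pi, f (-θ) := by
    simp [intervalIntegral.integral_comp_neg]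
  rw [← intervalIntegral.integral_add_adjacent_intervals (b := 0)
    (hfc.intervalIntegrable _ _) (hfc.intervalIntegrable _ _), h1,
    ← intervalIntegral.integral_add (f := fun θ => f (-θ))
      ((hfc.comp continuous_neg).intervalIntegrable _ _) (hfc.intervalIntegrable _ _), ← intervalIntegral.integral_const_mul,
    ← intervalIntegral.integral_ofReal]
  refine intervalIntegral.integral_congr fun θ _ => ?_
  have hc := Complex.two_cos (n * θ : ℂ)
  simp only [hf, Real.cos_neg, Complex.ofReal_neg, Complex.ofReal_mul, Complex.ofReal_cos,
    Complex.ofReal_intCast, Complex.ofReal_ofNat]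
  linear_combination (g (Real.cos θ) : ℂ) * (-hc) + (g (Real.cos θ) : ℂ) *
    congrArg Complex.exp (show -((n : ℂ) * -(θ : ℂ) * Complex.I) = n * θ * Complex.I by ring) + (g (Real.cos θ) : ℂ) *
    congrArg Complex.exp (show -((n : ℂ) * (θ : ℂ) * Complex.I) = -(n * θ) * Complex.I by ring)

instance : Fact (0 < 2 * Real.pi) := ⟨Real.two_pi_pos⟩

/-- A function of `cos θ`, as a continuous complex function on the circle. -/
noncomputable def circleLift (g : ℝ → ℝ) (hg : Continuous g) : C(AddCircle (2 * Real.pi), ℂ) where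
  toFun := Function.Periodic.lift (f := fun θ : ℝ => (g (Real.cos θ) : ℂ)) (c := 2 * Real.pi)
    fun θ => by simp only [Real.cos_add_two_pi]
  continuous_toFun := by
    apply continuous_coinduced_dom.mpr
    change Continuous fun θ : ℝ => (g (Real.cos θ) : ℂ)
    fun_prop

lemma circleLift_coe (g : ℝ → ℝ) (hg : Continuous g) (θ : ℝ) :
    circleLift g hg (θ : AddCircle (2 * Real.pi)) = (g (Real.cos θ) : ℂ) := rfl

lemma fourierCoeff_circleLift (g : ℝ → ℝ) (hg : Continuous g) (n : ℤ) :
    fourierCoeff (circleLift g hg) n =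
      ((1 / Real.pi * ∫ θ in (0 : ℝ)..Real.pi, g (Real.cos θ) * Real.cos (n * θ) : ℝ) : ℂ) := by
  have hpi : (Real.pi : ℂ) ≠ 0 := by exact_mod_cast Real.pi_ne_zero
  have h : (∫ θ in (-Real.pi)..Real.pi,
      fourier (-n) (θ : AddCircle (2 * Real.pi)) • circleLift g hg (θ : AddCircle (2 * Real.pi))) =
      ∫ θ in (-Real.pi)..Real.pi, Complex.exp (-(n * θ * Complex.I)) * (g (Real.cos θ) : ℂ) := by
    refine intervalIntegral.integral_congr fun θ _ => ?_
    simp only [fourier_coe_apply, circleLift_coe, smul_eq_mul]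
    congr 2
    push_cast
    field_simp
  rw [fourierCoeff_eq_intervalIntegral _ _ (-Real.pi), show -Real.pi + 2 * Real.pi = Real.pi by ring,
    h, integral_exp_mul_comp_cos g hg, Complex.real_smul]
  push_cast
  field_simp

lemma chebyshevCoeff_zero_eq (g : ℝ → ℝ) (hg : Continuous g) :
    fourierCoeff (circleLift g hg) 0 = (chebyshevCoeff g 0 : ℂ) := by
  simp [fourierCoeff_circleLift, chebyshevCoeff]

/-- Evenness splits each cosine coefficient equally between the frequencies `n` and `-n`; the zero
frequency is not split, which is the source of the extra factor `1 / 2` in `c_0`. -/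
lemma chebyshevCoeff_eq (g : ℝ → ℝ) (hg : Continuous g) {n : ℕ} (hn : n ≠ 0) :
    fourierCoeff (circleLift g hg) n = ((chebyshevCoeff g n / 2 : ℝ) : ℂ) ∧
    fourierCoeff (circleLift g hg) (-n) = ((chebyshevCoeff g n / 2 : ℝ) : ℂ) := by
  simp only [fourierCoeff_circleLift, chebyshevCoeff, if_neg hn]
  constructor
  · congr 1
    push_cast
    ring
  · congr 1
    push_cast
    simp only [neg_mul, Real.cos_neg]
    ring

/-- A Chebyshev series with geometrically decaying coefficients converges to the function. -/
lemma hasSum_chebyshevCoeff_mul_cos (g : ℝ → ℝ) (hg : Continuous g) {K r : ℝ} (hr0 : 0 ≤ r)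
    (hr1 : r < 1) (hc : ∀ n : ℕ, |chebyshevCoeff g n| ≤ K * r ^ n) (θ : ℝ) :
    HasSum (fun n : ℕ => chebyshevCoeff g n * Real.cos (n * θ)) (g (Real.cos θ)) := by
  have hK : 0 ≤ K := by simpa using (abs_nonneg _).trans (hc 0)
  have hgeo : Summable fun n : ℕ => K * r ^ n :=
    (summable_geometric_of_lt_one hr0 hr1).mul_left K
  have hle : ∀ n : ℕ, |chebyshevCoeff g n / 2| ≤ K * r ^ n := fun n => by
    rw [abs_div, abs_two]
    linarith [hc n, abs_nonneg (chebyshevCoeff g n)]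
  have hs : Summable (fourierCoeff (circleLift g hg)) := by
    rw [summable_int_iff_summable_nat_and_neg]
    constructor <;> refine Summable.of_norm_bounded_eventually_nat hgeo ?_ <;>
      filter_upwards [Filter.eventually_ne_atTop 0] with n hn
    · rw [(chebyshevCoeff_eq g hg hn).1, Complex.norm_real]
      exact hle n
    · rw [(chebyshevCoeff_eq g hg hn).2, Complex.norm_real]
      exact hle n
  have h := (has_pointwise_sum_fourier_series_of_summable hs
    (θ : AddCircle (2 * Real.pi))).nat_add_neg
  have hf0 : fourierCoeff (circleLift g hg) 0 • fourier 0 (θ : AddCircle (2 * Real.pi)) =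
      (chebyshevCoeff g 0 : ℂ) := by
    simp [chebyshevCoeff_zero_eq]
  -- Pairing `n` with `-n` over the naturals counts frequency `0` twice; this series removes the
  -- surplus copy.
  have h0 : HasSum (fun n : ℕ => if n = 0 then (chebyshevCoeff g 0 : ℂ) else 0)
      (chebyshevCoeff g 0 : ℂ) := hasSum_ite_eq 0 _
  have h2 := h.sub h0
  rw [hf0, add_sub_cancel_right, circleLift_coe] at h2
  rw [← Complex.hasSum_ofReal]
  convert! h2 using 2 with n
  rcases eq_or_ne n 0 with rfl | hn
  · simp [chebyshevCoeff_zero_eq]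
  · have h2c := Complex.two_cos (n * θ : ℂ)
    have hpi : (Real.pi : ℂ) ≠ 0 := by exact_mod_cast Real.pi_ne_zero
    have e1 : 2 * (Real.pi : ℂ) * Complex.I * ((n : ℤ) : ℂ) * θ / ((2 * Real.pi : ℝ) : ℂ) =
        n * θ * Complex.I := by
      push_cast
      field_simp
    have e2 : 2 * (Real.pi : ℂ) * Complex.I * ((-(n : ℤ) : ℤ) : ℂ) * θ / ((2 * Real.pi : ℝ) : ℂ) =
        -(n * θ) * Complex.I := by
      push_cast
      field_simp
    rw [(chebyshevCoeff_eq g hg hn).1, (chebyshevCoeff_eq g hg hn).2, fourier_coe_apply,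
      fourier_coe_apply, e1, e2, if_neg hn, sub_zero, ← smul_add, ← h2c]
    simp only [smul_eq_mul, Complex.ofReal_mul, Complex.ofReal_cos, Complex.ofReal_div,
      Complex.ofReal_natCast, Complex.ofReal_ofNat]
    ring

/-- Truncation error of a Chebyshev series with geometrically decaying coefficients. -/
lemma abs_sum_chebyshevCoeff_sub_le (g : ℝ → ℝ) (hg : Continuous g) {K r : ℝ} (hr0 : 0 ≤ r)
    (hr1 : r < 1) (hc : ∀ n : ℕ, |chebyshevCoeff g n| ≤ K * r ^ n) (N : ℕ) (θ : ℝ) :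
    |∑ j ∈ Finset.range (N + 1), chebyshevCoeff g j * Real.cos (j * θ) - g (Real.cos θ)| ≤
      K * r ^ (N + 1) / (1 - r) := by
  have h := hasSum_chebyshevCoeff_mul_cos g hg hr0 hr1 hc θ
  have ht := (hasSum_nat_add_iff' (N + 1)).mpr h
  have hgeo : HasSum (fun n : ℕ => K * r ^ (N + 1) * r ^ n) (K * r ^ (N + 1) / (1 - r)) :=
    (hasSum_geometric_of_lt_one hr0 hr1).mul_left _
  rw [abs_sub_comm, ← Real.norm_eq_abs, ← ht.tsum_eq]
  refine tsum_of_norm_bounded hgeo fun n => ?_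
  rw [norm_mul, Real.norm_eq_abs, Real.norm_eq_abs]
  calc |chebyshevCoeff g (n + (N + 1))| * |Real.cos (((n + (N + 1) : ℕ) : ℝ) * θ)|
      ≤ K * r ^ (n + (N + 1)) * 1 :=
        mul_le_mul (hc _) (Real.abs_cos_le_one _) (abs_nonneg _) ((abs_nonneg _).trans (hc _))
    _ = K * r ^ (N + 1) * r ^ n := by ring

/-! ### Coefficient decay by a contour shift -/

/-- The complex image of `z` under the Joukowski map onto the ellipse around `[a, b]`. -/
noncomputable def joukowski (a b : ℝ) (z : ℂ) : ℂ :=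
  (b - a) / 4 * (z + z⁻¹) + (b + a) / 2

lemma joukowski_add_inv_lt {ρ r : ℝ} (h1 : 1 ≤ r) (h2 : r < ρ) : r + r⁻¹ < ρ + ρ⁻¹ := by
  have hr : 0 < r := by linarith
  have hρ : 0 < ρ := by linarith
  have : ρ + ρ⁻¹ - (r + r⁻¹) = (ρ - r) * (1 - (ρ * r)⁻¹) := by
    field_simp
    ring
  have h3 : (ρ * r)⁻¹ < 1 := inv_lt_one_of_one_lt₀ (by nlinarith)
  nlinarith [mul_pos (sub_pos.2 h2) (sub_pos.2 h3)]

/-- Keeps the image of the annulus `1 ≤ ‖z‖ < ρ` in the right half-plane, where the principal power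
is holomorphic: the lower bound is exactly `0` at `‖z‖ = ρ` and increases as `‖z‖` decreases to `1`.
-/
lemma joukowski_re_ge {a b : ℝ} (hab : a < b) (z : ℂ) :
    -((b - a) / 4 * (‖z‖ + ‖z‖⁻¹)) + (b + a) / 2 ≤ (joukowski a b z).re := by
  have h : |(z + z⁻¹).re| ≤ ‖z‖ + ‖z‖⁻¹ := by
    calc |(z + z⁻¹).re| ≤ ‖z + z⁻¹‖ := Complex.abs_re_le_norm _
      _ ≤ ‖z‖ + ‖z⁻¹‖ := norm_add_le _ _
      _ = _ := by rw [norm_inv]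
  have hre : (joukowski a b z).re = (b - a) / 4 * (z + z⁻¹).re + (b + a) / 2 := by
    have : joukowski a b z = ((b - a) / 4 : ℝ) * (z + z⁻¹) + ((b + a) / 2 : ℝ) := by
      simp [joukowski]
    rw [this, Complex.add_re, Complex.re_ofReal_mul, Complex.ofReal_re]
  rw [hre]
  nlinarith [neg_abs_le (z + z⁻¹).re]

lemma norm_joukowski_le {a b : ℝ} (ha : 0 < a) (hab : a < b) (z : ℂ) :
    ‖joukowski a b z‖ ≤ (b - a) / 4 * (‖z‖ + ‖z‖⁻¹) + (b + a) / 2 := by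
  have : joukowski a b z = ((b - a) / 4 : ℝ) * (z + z⁻¹) + ((b + a) / 2 : ℝ) := by
    simp [joukowski]
  rw [this]
  refine (norm_add_le _ _).trans ?_
  rw [norm_mul, Complex.norm_real, Complex.norm_real, Real.norm_of_nonneg (by linarith),
    Real.norm_of_nonneg (by linarith), ← norm_inv z]
  gcongr
  exact norm_add_le _ _

lemma joukowski_exp (a b θ : ℝ) :
    joukowski a b (Complex.exp (θ * Complex.I)) =
      (((b - a) / 2 * Real.cos θ + (b + a) / 2 : ℝ) : ℂ) := by
  have h := Complex.two_cos (θ : ℂ)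
  rw [joukowski, ← Complex.exp_neg, ← neg_mul, ← h]
  push_cast
  ring

/-- The function `x ^ q` on `[a, b]`, transported to `[-1, 1]`, has Chebyshev coefficients that
decay like `ρ ^ (-n)` when `ρ + ρ⁻¹ = 2 (b + a) / (b - a)`. -/
lemma abs_integral_rpow_cos_le {a b q ρ : ℝ} (ha : 0 < a) (hab : a < b) (hq : 0 < q)
    (hρ1 : 1 < ρ) (hρ : (b - a) / 4 * (ρ + ρ⁻¹) = (b + a) / 2) (n : ℕ) :
    |∫ θ in (0 : ℝ)..Real.pi,
      ((b - a) / 2 * Real.cos θ + (b + a) / 2) ^ q * Real.cos (n * θ)| ≤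
      Real.pi * ((b + a) ^ q * ρ⁻¹ ^ n) := by
  set g : ℝ → ℝ := fun t => ((b - a) / 2 * t + (b + a) / 2) ^ q with hgdef
  have hg : Continuous g := by
    apply Continuous.rpow_const (by fun_prop)
    exact fun _ => Or.inr hq.le
  -- On the unit circle `z⁻¹ * f z` integrates to the coefficient; on the circle of radius `ρ` the
  -- factor `z⁻¹ ^ n` supplies the decay.
  set f : ℂ → ℂ := fun z => z⁻¹ ^ n * joukowski a b z ^ (q : ℂ) with hf
  have hne : ∀ z : ℂ, 1 ≤ ‖z‖ → z ≠ 0 := by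
    rintro z hz rfl
    norm_num at hz
  have hlt4 : 0 < (b - a) / 4 := by linarith
  have hpos : ∀ z : ℂ, 1 ≤ ‖z‖ → ‖z‖ < ρ → 0 < (joukowski a b z).re := fun z h1 h2 => by
    have := joukowski_re_ge hab z
    nlinarith [joukowski_add_inv_lt h1 h2]
  have hnonneg : ∀ z : ℂ, 1 ≤ ‖z‖ → ‖z‖ ≤ ρ → 0 ≤ (joukowski a b z).re := fun z h1 h2 => by
    rcases h2.lt_or_eq with h2 | h2
    · exact (hpos z h1 h2).le
    · have := joukowski_re_ge hab z
      rw [h2] at this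
      linarith
  have hjd : ∀ z : ℂ, z ≠ 0 → DifferentiableAt ℂ (joukowski a b) z := fun z hz => by
    unfold joukowski
    fun_prop (disch := assumption)
  have key := Complex.circleIntegral_sub_center_inv_smul_eq_of_differentiable_on_annulus_off_countable
    (c := 0) (r := 1) (R := ρ) one_pos hρ1.le (f := f) (s := ∅) Set.countable_empty ?_ ?_
  rotate_left
  · rintro z ⟨hz1, hz2⟩
    simp only [mem_closedBall_zero_iff, Metric.mem_ball, dist_zero_right, not_lt] at hz1 hz2
    refine ContinuousAt.continuousWithinAt (ContinuousAt.mul ?_ ?_)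
    · exact (continuousAt_inv₀ (hne z hz2)).pow n
    -- The outer circle reaches the branch point `0` at `z = -ρ`; the power is still continuous
    -- there because `q > 0`.
    · exact ContinuousAt.comp (f := joukowski a b) (g := fun w : ℂ => w ^ (q : ℂ))
        (Complex.continuousAt_cpow_const_of_re_pos (Or.inl (hnonneg z hz2 hz1)) (by simpa using hq))
        (hjd z (hne z hz2)).continuousAt
  · rintro z ⟨⟨hz1, hz2⟩, -⟩
    simp only [mem_closedBall_zero_iff, Metric.mem_ball, dist_zero_right, not_le] at hz1 hz2
    refine DifferentiableAt.mul ?_ ?_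
    · exact (differentiableAt_inv (hne z hz2.le)).pow n
    · exact (hjd z (hne z hz2.le)).cpow (differentiableAt_const _)
        (Or.inl (hpos z hz2.le hz1))
  have hleft : (∮ z in C(0, 1), (z - 0)⁻¹ • f z) = Complex.I *
      ((2 * ∫ θ in (0 : ℝ)..Real.pi, g (Real.cos θ) * Real.cos ((n : ℤ) * θ) : ℝ) : ℂ) := by
    rw [← integral_exp_mul_comp_cos g hg, ← intervalIntegral.integral_const_mul, circleIntegral]
    -- The circle integral runs over `[0, 2π]`, the Fourier integral over `[-π, π]`.
    have hper : Function.Periodic (fun θ : ℝ => Complex.I *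
        (Complex.exp (-((n : ℤ) * θ * Complex.I)) * (g (Real.cos θ) : ℂ))) (2 * Real.pi) := by
      intro θ
      have : Complex.exp (-((n : ℤ) * ((θ + 2 * Real.pi : ℝ) : ℂ) * Complex.I)) =
          Complex.exp (-((n : ℤ) * θ * Complex.I)) := by
        rw [Complex.exp_eq_exp_iff_exists_int]
        exact ⟨-n, by push_cast; ring⟩
      simp only [this, Real.cos_add_two_pi]
    have h2 := hper.intervalIntegral_add_eq (-Real.pi) 0
    rw [show -Real.pi + 2 * Real.pi = Real.pi by ring, zero_add] at h2
    rw [h2]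
    refine intervalIntegral.integral_congr fun θ _ => ?_
    have hx : 0 ≤ (b - a) / 2 * Real.cos θ + (b + a) / 2 := by
      nlinarith [Real.neg_one_le_cos θ]
    have he : Complex.exp (θ * Complex.I) ≠ 0 := Complex.exp_ne_zero _
    simp only [hf, deriv_circleMap, circleMap_zero, Complex.ofReal_one, one_mul, sub_zero,
      joukowski_exp, smul_eq_mul, hgdef, Complex.ofReal_cpow hx]
    rw [← Complex.exp_neg, ← Complex.exp_nat_mul,
      show (n : ℂ) * -(θ * Complex.I) = -(((n : ℤ) : ℂ) * θ * Complex.I) by push_cast; ring,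
      Complex.exp_neg]
    field_simp
  have hright : ‖∮ z in C(0, ρ), (z - 0)⁻¹ • f z‖ ≤
      2 * Real.pi * ρ * (ρ⁻¹ * ((b + a) ^ q * ρ⁻¹ ^ n)) := by
    refine circleIntegral.norm_integral_le_of_norm_le_const (by linarith) fun z hz => ?_
    have hz : ‖z‖ = ρ := by simpa using hz
    have hj := norm_joukowski_le ha hab z
    rw [hz, hρ] at hj
    rw [sub_zero, norm_smul, norm_inv, hz, hf]
    simp only [norm_mul, norm_pow, norm_inv, hz, Complex.norm_cpow_real]
    rw [mul_comm (ρ⁻¹ ^ n)]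
    have : 0 ≤ ρ := by linarith
    gcongr
    linarith
  rw [key, hleft, norm_mul, Complex.norm_I, one_mul, Complex.norm_real, Real.norm_eq_abs,
    abs_mul, abs_two] at hright
  have hρ0 : ρ ≠ 0 := by linarith
  have e : 2 * Real.pi * ρ * (ρ⁻¹ * ((b + a) ^ q * ρ⁻¹ ^ n)) =
    2 * (Real.pi * ((b + a) ^ q * ρ⁻¹ ^ n)) := by field_simp
  rw [e] at hright
  push_cast at hright
  linarith

lemma abs_chebyshevCoeff_rpow_le {a b q ρ : ℝ} (ha : 0 < a) (hab : a < b) (hq : 0 < q)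
    (hρ1 : 1 < ρ) (hρ : (b - a) / 4 * (ρ + ρ⁻¹) = (b + a) / 2) (n : ℕ) :
    |chebyshevCoeff (fun t => ((b - a) / 2 * t + (b + a) / 2) ^ q) n| ≤
      2 * (b + a) ^ q * ρ⁻¹ ^ n := by
  have h := abs_integral_rpow_cos_le ha hab hq hρ1 hρ n
  have hpi := Real.pi_pos
  have hle : |(if n = 0 then 1 / Real.pi else 2 / Real.pi : ℝ)| ≤ 2 / Real.pi := by
    split_ifs
    · rw [abs_of_pos (by positivity)]
      gcongr
      norm_num
    · rw [abs_of_pos (by positivity)]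
  rw [chebyshevCoeff, abs_mul]
  calc _ ≤ 2 / Real.pi * (Real.pi * ((b + a) ^ q * ρ⁻¹ ^ n)) :=
        mul_le_mul hle h (abs_nonneg _) (by positivity)
    _ = _ := by field_simp

/-! ### Approximation error and the degree bound -/

/-- Error of the Chebyshev approximation of `x ^ (p / 2)` on `[a, b]`. -/
lemma abs_eval_psiPoly_sub_le {a b p ρ : ℝ} (ha : 0 < a) (hab : a < b) (hp : 0 < p)
    (hρ1 : 1 < ρ) (hρ : (b - a) / 4 * (ρ + ρ⁻¹) = (b + a) / 2) (N : ℕ) {x : ℝ}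
    (hx : x ∈ Set.Icc a b) :
    |(psiPoly a b p N).eval x - x ^ (p / 2)| ≤
      2 * (b + a) ^ (p / 2) * ρ⁻¹ ^ (N + 1) / (1 - ρ⁻¹) := by
  have hba : 0 < b - a := by linarith
  have ht1 : -1 ≤ 2 / (b - a) * x - (b + a) / (b - a) := by
    rw [div_mul_eq_mul_div, ← sub_div, le_div_iff₀ hba]
    linarith [hx.1]
  have ht2 : 2 / (b - a) * x - (b + a) / (b - a) ≤ 1 := by
    rw [div_mul_eq_mul_div, ← sub_div, div_le_iff₀ hba]
    linarith [hx.2]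
  set θ := Real.arccos (2 / (b - a) * x - (b + a) / (b - a)) with hθ
  have hcos : Real.cos θ = 2 / (b - a) * x - (b + a) / (b - a) := Real.cos_arccos ht1 ht2
  have hxθ : (b - a) / 2 * Real.cos θ + (b + a) / 2 = x := by
    rw [hcos]
    field_simp
    ring
  have hg : Continuous fun t : ℝ => ((b - a) / 2 * t + (b + a) / 2) ^ (p / 2) := by
    apply Continuous.rpow_const (by fun_prop)
    exact fun _ => Or.inr (by linarith)
  have h := abs_sum_chebyshevCoeff_sub_le _ hg (inv_nonneg.2 (by linarith))
    (inv_lt_one_of_one_lt₀ hρ1) (abs_chebyshevCoeff_rpow_le ha hab (half_pos hp) hρ1 hρ) N θ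
  rw [hxθ] at h
  convert! h using 3
  rw [psiPoly, chebyshevApprox, eval_finsetSum]
  refine Finset.sum_congr rfl fun j _ => ?_
  have := Chebyshev.T_real_cos θ j
  rw [hcos] at this
  simp [this]

/-- The equation says that the leftmost point of the ellipse is `0`, so this `ρ` is the largest the
branch point permits. -/
lemma ellipse_param_identity {a b : ℝ} (ha : 0 < a) (hab : a < b) :
    1 < √(b / a) ∧ (b - a) / 4 * ((√(b / a) + 1) / (√(b / a) - 1) +
      ((√(b / a) + 1) / (√(b / a) - 1))⁻¹) = (b + a) / 2 := by
  set κ := √(b / a) with hκ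
  have h1 : 1 < κ := by
    rw [hκ, Real.lt_sqrt (by norm_num), one_pow, lt_div_iff₀ ha]
    linarith
  have hb : b = a * κ ^ 2 := by
    rw [hκ, Real.sq_sqrt (div_pos (ha.trans hab) ha).le]
    field_simp
  refine ⟨h1, ?_⟩
  have h2 : κ - 1 ≠ 0 := by linarith
  have h3 : κ + 1 ≠ 0 := by linarith
  rw [hb]
  field_simp
  ring

/-- Under the degree bound the Chebyshev approximation has relative error at most `ε / 8`. -/
lemma abs_eval_psiPoly_sub_le_of_degreeBound {a b p ε : ℝ} (ha : 0 < a) (hab : a < b) (hp : 0 < p)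
    (hε : 0 < ε) {N : ℕ} (hN : chebyshevDegreeBound a b p ε ≤ (N : ℝ)) {x : ℝ}
    (hx : x ∈ Set.Icc a b) :
    |(psiPoly a b p N).eval x - x ^ (p / 2)| ≤ ε / 8 * x ^ (p / 2) := by
  obtain ⟨hκ1, hρ⟩ := ellipse_param_identity ha hab
  have hκa : a * (√(b / a) ^ 2 + 1) = b + a := by
    rw [Real.sq_sqrt (div_pos (ha.trans hab) ha).le]
    field_simp
  simp only [chebyshevDegreeBound] at hN
  set κ := √(b / a) with hκ
  set ρ := (κ + 1) / (κ - 1) with hρdef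
  have hκ0 : 0 < κ - 1 := by linarith
  have hρ1 : 1 < ρ := by
    rw [hρdef, lt_div_iff₀ hκ0]
    linarith
  set D := κ ^ p + √(ε / 2 + κ ^ (2 * p)) with hD
  -- Only this lower bound on the last factor enters: it turns `4 / ε` into `8 / ε`.
  have hD2 : 2 ≤ D := by
    have h1 : 1 ≤ κ ^ p := Real.one_le_rpow hκ1.le hp.le
    have h2 : 1 ≤ κ ^ (2 * p) := Real.one_le_rpow hκ1.le (by linarith)
    have h3 : 1 ≤ √(ε / 2 + κ ^ (2 * p)) := by
      rw [Real.one_le_sqrt]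
      linarith
    linarith
  have hP : 0 < (κ ^ 2 + 1) ^ (p / 2) := by positivity
  have hK : 4 / ε * (κ ^ 2 + 1) ^ (p / 2) * (κ - 1) * D ≤ ρ ^ N := by
    rw [div_le_iff₀ (Real.log_pos hρ1), ← Real.log_pow] at hN
    exact (Real.log_le_log_iff (by positivity) (by positivity)).1 hN
  have h := abs_eval_psiPoly_sub_le ha hab hp hρ1 hρ N hx
  have hap : 0 < a ^ (p / 2) := Real.rpow_pos_of_pos ha _
  have hax : a ^ (p / 2) ≤ x ^ (p / 2) := Real.rpow_le_rpow ha.le hx.1 (by linarith)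
  have hρN : 0 < ρ ^ N := by positivity
  have e : 2 * (b + a) ^ (p / 2) * ρ⁻¹ ^ (N + 1) / (1 - ρ⁻¹) =
      a ^ (p / 2) * ((κ ^ 2 + 1) ^ (p / 2) * (κ - 1) / ρ ^ N) := by
    rw [← hκa, Real.mul_rpow ha.le (by positivity)]
    have h1 : ρ - 1 = 2 / (κ - 1) := by
      rw [hρdef]
      field_simp
      ring
    have h2 : ρ⁻¹ ^ (N + 1) / (1 - ρ⁻¹) = (κ - 1) / 2 / ρ ^ N := by
      have h3 : ρ - 1 ≠ 0 := by linarith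
      have h4 : (κ - 1) / 2 = (ρ - 1)⁻¹ := by rw [h1, inv_div]
      have h5 : (1 : ℝ) - ρ⁻¹ = (ρ - 1) / ρ := by field_simp
      rw [h4, h5, inv_pow]
      field_simp
      ring
    rw [mul_div_assoc, h2]
    ring
  rw [e] at h
  have hfin : (κ ^ 2 + 1) ^ (p / 2) * (κ - 1) / ρ ^ N ≤ ε / 8 := by
    rw [div_le_iff₀ hρN]
    have h1 : 4 / ε * (κ ^ 2 + 1) ^ (p / 2) * (κ - 1) * 2 ≤ ρ ^ N :=
      le_trans (by gcongr) hK
    calc (κ ^ 2 + 1) ^ (p / 2) * (κ - 1)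
        = ε / 8 * (4 / ε * (κ ^ 2 + 1) ^ (p / 2) * (κ - 1) * 2) := by
          field_simp
          norm_num
      _ ≤ _ := by gcongr
  calc _ ≤ _ := h
    _ ≤ x ^ (p / 2) * (ε / 8) := by
      have := hap.le.trans hax
      gcongr
    _ = _ := mul_comm _ _

/-- Under the degree bound `ψ_N ^ 2` approximates `x ^ p` up to the relative error `ε / 2`. -/
lemma abs_sq_eval_psiPoly_sub_le {a b p ε : ℝ} (ha : 0 < a) (hab : a < b) (hp : 0 < p)
    (hε : 0 < ε) (hε1 : ε ≤ 1) {N : ℕ} (hN : chebyshevDegreeBound a b p ε ≤ (N : ℝ)) {x : ℝ}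
    (hx : x ∈ Set.Icc a b) :
    |(psiPoly a b p N).eval x ^ 2 - x ^ p| ≤ ε / 2 * x ^ p := by
  have h := abs_eval_psiPoly_sub_le_of_degreeBound ha hab hp hε hN hx
  have hx0 : 0 < x := ha.trans_le hx.1
  have hxp : x ^ p = (x ^ (p / 2)) ^ 2 := by
    rw [← Real.rpow_natCast, ← Real.rpow_mul hx0.le]
    norm_num
  have hy : 0 < x ^ (p / 2) := Real.rpow_pos_of_pos hx0 _
  rw [hxp]
  set y := x ^ (p / 2)
  set u := (psiPoly a b p N).eval x
  have h2 : |u + y| ≤ (2 + ε / 8) * y := by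
    rw [abs_le] at h ⊢
    constructor <;> nlinarith
  calc |u ^ 2 - y ^ 2| = |u - y| * |u + y| := by rw [← abs_mul]; ring_nf
    _ ≤ (ε / 8 * y) * ((2 + ε / 8) * y) := by gcongr
    _ = (ε / 8 * (2 + ε / 8)) * y ^ 2 := by ring
    _ ≤ ε / 2 * y ^ 2 := by
      gcongr
      nlinarith

/-! ### Spectral reduction -/

/-- A symmetric matrix acts diagonally in its eigenbasis, and so does any polynomial in it. -/
lemma aeval_eq_conj_diagonal {n : ℕ} {A : Matrix (Fin n) (Fin n) ℝ} (hA : A.IsHermitian)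
    (P : ℝ[X]) :
    aeval A P = Unitary.conjStarAlgAut ℝ _ hA.eigenvectorUnitary
      (Matrix.diagonal fun i => P.eval (hA.eigenvalues i)) := by
  have h : aeval (Matrix.diagonal hA.eigenvalues) P =
      Matrix.diagonal fun i => P.eval (hA.eigenvalues i) := by
    have h2 := Polynomial.aeval_algHom_apply (Matrix.diagonalAlgHom (n := Fin n) (α := ℝ) ℝ) hA.eigenvalues P
    rw [Matrix.diagonalAlgHom_apply] at h2
    rw [h2, Matrix.diagonalAlgHom_apply]
    congr 1
    ext i
    rw [Polynomial.aeval_pi_apply]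
    simp
  conv_lhs => rw [hA.spectral_theorem]
  rw [← h]
  exact Polynomial.aeval_algHom_apply
    (Unitary.conjStarAlgAut ℝ (Matrix (Fin n) (Fin n) ℝ) hA.eigenvectorUnitary) _ P

lemma phiMatrix_eq {n : ℕ} {A : Matrix (Fin n) (Fin n) ℝ} (hA : A.IsHermitian) (a b p : ℝ)
    (N : ℕ) :
    phiMatrix a b p N A = (hA.eigenvectorUnitary : Matrix (Fin n) (Fin n) ℝ) *
      (Matrix.diagonal fun i => (psiPoly a b p N).eval (hA.eigenvalues i) ^ 2) *
      (hA.eigenvectorUnitary : Matrix (Fin n) (Fin n) ℝ).transpose := by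
  rw [phiMatrix, ← map_pow, aeval_eq_conj_diagonal hA, Unitary.conjStarAlgAut_apply]
  simp [Matrix.star_eq_conjTranspose, Matrix.conjTranspose_eq_transpose_of_trivial]

lemma dotProduct_phiMatrix_mulVec {n : ℕ} {A : Matrix (Fin n) (Fin n) ℝ} (hA : A.IsHermitian)
    (a b p : ℝ) (N : ℕ) (v : Fin n → ℝ) :
    v ⬝ᵥ (phiMatrix a b p N A).mulVec v =
      ∑ i, (psiPoly a b p N).eval (hA.eigenvalues i) ^ 2 *
        ((hA.eigenvectorUnitary : Matrix (Fin n) (Fin n) ℝ).transpose.mulVec v i) ^ 2 := by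
  rw [phiMatrix_eq hA, ← Matrix.mulVec_mulVec, ← Matrix.mulVec_mulVec, Matrix.dotProduct_mulVec,
    ← Matrix.mulVec_transpose, dotProduct]
  refine Finset.sum_congr rfl fun i _ => ?_
  rw [Matrix.mulVec_diagonal]
  ring

/-- The Schatten norm of a positive definite matrix in terms of its eigenvalues. -/
lemma schattenNorm_eq_sum_eigenvalues {n : ℕ} {A : Matrix (Fin n) (Fin n) ℝ} (hA : A.PosDef)
    (p : ℝ) :
    schattenNorm p A = (∑ i, hA.isHermitian.eigenvalues i ^ p) ^ (1 / p) := by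
  set T := Matrix.toEuclideanLin A with hT
  have hadj : LinearMap.adjoint T ∘ₗ T = Matrix.toEuclideanLin (A ^ 2) := by
    rw [hT, ← Matrix.toEuclideanLin_conjTranspose_eq_adjoint, hA.isHermitian.eq]
    ext v i
    simp [pow_two, Matrix.toLpLin_apply]
  have hn : Module.finrank ℝ (EuclideanSpace ℝ (Fin n)) = n := by simp
  have hsq : A ^ 2 = Unitary.conjStarAlgAut ℝ _ hA.isHermitian.eigenvectorUnitary
      (Matrix.diagonal fun i => hA.isHermitian.eigenvalues i ^ 2) := by
    have := aeval_eq_conj_diagonal hA.isHermitian (X ^ 2)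
    simpa using this
  have hchar : (LinearMap.adjoint T ∘ₗ T).charpoly =
      ∏ i, (X - C (hA.isHermitian.eigenvalues i ^ 2)) := by
    have h1 : (Matrix.toEuclideanLin (A ^ 2)).charpoly = (A ^ 2).charpoly := by
      rw [Matrix.toEuclideanLin, Matrix.toLpLin_eq_toLin, ← LinearMap.charpoly_toMatrix _ (PiLp.basisFun 2 ℝ (Fin n)),
        LinearMap.toMatrix_toLin]
    rw [hadj, h1, hsq, Unitary.conjStarAlgAut_apply, Matrix.charpoly_mul_comm, ← mul_assoc]
    simp [Matrix.charpoly_diagonal]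
  -- The two families of eigenvalues may be ordered differently, so they are compared as multisets
  -- of roots of one characteristic polynomial; the power sum depends on nothing more.
  have hroots : Multiset.map (T.isSymmetric_adjoint_comp_self.eigenvalues hn) Finset.univ.val =
      Multiset.map (fun i => hA.isHermitian.eigenvalues i ^ 2) Finset.univ.val := by
    have h := T.isSymmetric_adjoint_comp_self.roots_charpoly_eq_eigenvalues hn
    rw [hchar, Polynomial.roots_prod _ _ (Finset.prod_ne_zero_iff.2 fun _ _ => X_sub_C_ne_zero _)] at h
    simp only [roots_X_sub_C, Multiset.bind_singleton, RCLike.ofReal_real_eq_id,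
      Function.id_comp] at h
    exact h.symm
  rw [schattenNorm, min_self, Finset.sum_range]
  congr 1
  have h2 : ∀ i : Fin n, T.singularValues i ^ p =
      (fun t => (√t) ^ p) (T.isSymmetric_adjoint_comp_self.eigenvalues hn i) := fun i => by
    rw [T.singularValues_fin hn]
  have h3 : ∀ i, hA.isHermitian.eigenvalues i ^ p =
      (fun t => (√t) ^ p) (hA.isHermitian.eigenvalues i ^ 2) := fun i => by
    simp only [Real.sqrt_sq (hA.eigenvalues_pos i).le]
  rw [Finset.sum_congr rfl fun i _ => h2 i, Finset.sum_congr rfl fun i _ => h3 i]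
  have h4 := congrArg (fun s => (Multiset.map (fun t : ℝ => (√t) ^ p) s).sum) hroots
  simp only [Multiset.map_map] at h4
  exact h4

/-! ### Gaussian rotation invariance, moments and exponential moments -/

/-- An orthogonal transformation of a family of independent standard normal variables is again a
family of independent standard normal variables. -/
lemma iIndepFun_hasLaw_mulVec {Ω ι : Type*} [MeasurableSpace Ω] {μ : Measure Ω}
    [IsProbabilityMeasure μ] [Fintype ι] [DecidableEq ι] {X : ι → Ω → ℝ} (hX : iIndepFun X μ)
    (hlaw : ∀ i, HasLaw (X i) (gaussianReal 0 1) μ) {Q : Matrix ι ι ℝ}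
    (hQ : Q ∈ unitary (Matrix ι ι ℝ)) :
    iIndepFun (fun i ω => Q.mulVec (fun k => X k ω) i) μ ∧
      ∀ i, HasLaw (fun ω => Q.mulVec (fun k => X k ω) i) (gaussianReal 0 1) μ := by
  have hXm : ∀ i, AEMeasurable (X i) μ := fun i => (hlaw i).aemeasurable
  have hjoint : μ.map (fun ω i => X i ω) = Measure.pi fun _ : ι => gaussianReal 0 1 := by
    rw [(iIndepFun_iff_map_fun_eq_pi_map hXm).1 hX]
    simp_rw [(hlaw _).map_eq]
  have hQm : Measurable fun v : ι → ℝ => Q.mulVec v := by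
    fun_prop
  have hpres : (Measure.pi fun _ : ι => gaussianReal 0 1).map (fun v => Q.mulVec v) =
      Measure.pi fun _ : ι => gaussianReal 0 1 := by
    have hU : Matrix.toEuclideanCLM (𝕜 := ℝ) Q ∈
        unitary (EuclideanSpace ℝ ι →L[ℝ] EuclideanSpace ℝ ι) :=
      Unitary.map_mem (Matrix.toEuclideanCLM (n := ι) (𝕜 := ℝ)) hQ
    have h := stdGaussian_map (Unitary.linearIsometryEquiv
      (⟨_, hU⟩ : unitary (EuclideanSpace ℝ ι →L[ℝ] EuclideanSpace ℝ ι)))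
    rw [← map_pi_eq_stdGaussian] at h
    have h2 := congrArg (fun ν => ν.map (WithLp.ofLp : EuclideanSpace ℝ ι → ι → ℝ)) h
    simp only at h2
    rw [Measure.map_map (by fun_prop) (by fun_prop), Measure.map_map (by fun_prop) (by fun_prop),
      Measure.map_map (by fun_prop) (by fun_prop)] at h2
    have e1 : (WithLp.ofLp : EuclideanSpace ℝ ι → ι → ℝ) ∘ WithLp.toLp 2 = id := rfl
    rw [e1, Measure.map_id] at h2
    convert! h2 using 2
  have hmap : μ.map (fun ω i => Q.mulVec (fun k => X k ω) i) =
      Measure.pi fun _ : ι => gaussianReal 0 1 := by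
    have := AEMeasurable.map_map_of_aemeasurable (μ := μ) (f := fun ω i => X i ω)
      hQm.aemeasurable (aemeasurable_pi_lambda _ hXm)
    rw [hjoint, hpres] at this
    exact this.symm
  have hYm : AEMeasurable (fun ω i => Q.mulVec (fun k => X k ω) i) μ :=
    hQm.comp_aemeasurable (aemeasurable_pi_lambda _ hXm)
  have hlaw' : ∀ i, HasLaw (fun ω => Q.mulVec (fun k => X k ω) i) (gaussianReal 0 1) μ := by
    intro i
    refine ⟨(measurable_pi_apply i).comp_aemeasurable hYm, ?_⟩
    have := AEMeasurable.map_map_of_aemeasurable (μ := μ) (g := fun v : ι → ℝ => v i)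
      (measurable_pi_apply i).aemeasurable hYm
    rw [hmap, (measurePreserving_eval (fun _ : ι => gaussianReal 0 1) i).map_eq] at this
    exact this.symm
  refine ⟨?_, hlaw'⟩
  rw [iIndepFun_iff_map_fun_eq_pi_map fun i => (hlaw' i).aemeasurable, hmap]
  simp_rw [(hlaw' _).map_eq]

lemma integral_pow_four_gaussianReal : ∫ x, x ^ 4 ∂gaussianReal 0 1 = 3 := by
  have h := iteratedDeriv_mgf_zero (X := id) (μ := gaussianReal 0 1)
    (by simp [integrableExpSet_id_gaussianReal]) 4
  rw [mgf_id_gaussianReal] at h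
  simp only [Pi.pow_apply, id] at h
  rw [← h]
  have e0 : ∀ t : ℝ, HasDerivAt (fun t : ℝ => Real.exp (t ^ 2 / 2)) (t * Real.exp (t ^ 2 / 2)) t := by
    intro t
    have := (((hasDerivAt_pow 2 t).div_const 2).exp)
    convert! this using 1
    push_cast
    ring
  -- Differentiating `P * exp(t ^ 2 / 2)` acts on `P` as `P' + X * P`; four applications to `1`,
  -- evaluated at `0`, give `3`.
  have e1 : ∀ P : ℝ[X], deriv (fun t : ℝ => P.eval t * Real.exp (t ^ 2 / 2)) =
      fun t => (derivative P + X * P).eval t * Real.exp (t ^ 2 / 2) := by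
    intro P
    ext t
    refine ((P.hasDerivAt t).mul (e0 t)).deriv.trans ?_
    simp
    ring
  have e2 : (fun t : ℝ => Real.exp (0 * t + ((1 : NNReal) : ℝ) * t ^ 2 / 2)) =
      fun t => (1 : ℝ[X]).eval t * Real.exp (t ^ 2 / 2) := by
    ext t
    simp
  rw [e2, iteratedDeriv_succ', iteratedDeriv_succ', iteratedDeriv_succ', iteratedDeriv_succ',
    iteratedDeriv_zero, e1, e1, e1, e1]
  simp
  norm_num

lemma integral_sq_gaussianReal : ∫ x, x ^ 2 ∂gaussianReal 0 1 = 1 := by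
  have h := variance_fun_id_gaussianReal (μ := 0) (v := 1)
  rw [variance_of_integral_eq_zero (by fun_prop) (by simp)] at h
  simpa using h

lemma memLp_sq_gaussianReal : MemLp (fun x : ℝ => x ^ 2) 2 (gaussianReal 0 1) := by
  have h := (memLp_id_gaussianReal (μ := 0) (v := 1) 4)
  rw [memLp_two_iff_integrable_sq (by fun_prop)]
  have h4 := h.integrable_norm_pow (p := 4) (by norm_num)
  refine h4.congr (Filter.Eventually.of_forall fun x => ?_)
  simp only [id, Real.norm_eq_abs]
  rw [← pow_mul, show 2 * 2 = 4 from rfl, Even.pow_abs (by decide)]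

lemma variance_sq_gaussianReal : Var[fun x : ℝ => x ^ 2; gaussianReal 0 1] = 2 := by
  rw [variance_eq_sub memLp_sq_gaussianReal]
  have : ∫ x, ((fun x : ℝ => x ^ 2) ^ 2) x ∂gaussianReal 0 1 = 3 := by
    rw [← integral_pow_four_gaussianReal]
    refine integral_congr_ae (Filter.Eventually.of_forall fun x => ?_)
    simp only [Pi.pow_apply]
    ring
  rw [this, integral_sq_gaussianReal]
  norm_num

/-- The moment generating function of the square of a standard normal variable. -/
lemma mgf_sq_gaussianReal {t : ℝ} (ht : t < 1 / 2) :
    Integrable (fun x : ℝ => Real.exp (t * x ^ 2)) (gaussianReal 0 1) ∧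
    mgf (fun x : ℝ => x ^ 2) (gaussianReal 0 1) t = (√(1 - 2 * t))⁻¹ := by
  have hpdf : ∀ x : ℝ, gaussianPDFReal 0 1 x * Real.exp (t * x ^ 2) =
      (√(2 * Real.pi))⁻¹ * Real.exp (-(1 / 2 - t) * x ^ 2) := by
    intro x
    rw [gaussianPDFReal, mul_assoc, ← Real.exp_add]
    simp only [NNReal.coe_one, mul_one, sub_zero]
    congr 2
    ring
  have hb : 0 < 1 / 2 - t := by linarith
  constructor
  · rw [gaussianReal_of_var_ne_zero 0 one_ne_zero, integrable_withDensity_iff_integrable_smul₀'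
      (by fun_prop) (by simp [gaussianPDF_lt_top])]
    simp only [toReal_gaussianPDF, smul_eq_mul, hpdf]
    exact (integrable_exp_neg_mul_sq hb).const_mul _
  · rw [mgf, integral_gaussianReal_eq_integral_smul one_ne_zero]
    simp only [smul_eq_mul, hpdf]
    rw [integral_const_mul, integral_gaussian, ← Real.sqrt_inv, ← Real.sqrt_inv,
      ← Real.sqrt_mul (by positivity)]
    congr 1
    have : 1 - 2 * t ≠ 0 := by linarith
    have h2 : 1 / 2 - t ≠ 0 := hb.ne'
    have := Real.pi_ne_zero
    field_simp

/-- After squaring, this compares `exp(-(2u + 4u ^ 2))` with `1 - 2u`. A second-order bound on the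
exponential suffices for each sign of `u`. -/
lemma inv_sqrt_one_sub_le_exp {u : ℝ} (hu : |u| ≤ 1 / 4) :
    (√(1 - 2 * u))⁻¹ ≤ Real.exp (u + 2 * u ^ 2) := by
  obtain ⟨h1, h2⟩ := abs_le.1 hu
  have key : Real.exp (-(2 * (u + 2 * u ^ 2))) ≤ 1 - 2 * u := by
    rcases le_total 0 u with h | h
    · rw [Real.exp_neg, inv_le_comm₀ (Real.exp_pos _) (by linarith)]
      refine le_trans ?_ (Real.quadratic_le_exp_of_nonneg (by positivity))
      rw [inv_le_iff_one_le_mul₀ (by linarith)]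
      have h3 : 0 ≤ u ^ 2 * (1 - 2 * u - (2 * u) ^ 2 - (2 * u) ^ 3) := by
        apply mul_nonneg (sq_nonneg _)
        nlinarith [mul_nonneg h h, mul_nonneg h (mul_nonneg h h)]
      nlinarith
    · have hx : |(-(2 * (u + 2 * u ^ 2)))| ≤ 1 := by
        rw [abs_le]
        constructor <;> nlinarith
      have h3 := (abs_le.1 (Real.abs_exp_sub_one_sub_id_le hx)).2
      nlinarith [mul_nonneg_of_nonpos_of_nonpos h h, mul_nonneg (sq_nonneg u) (sub_nonneg.2 h1), mul_nonneg (sq_nonneg u) (neg_nonneg.2 h)]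
  have hpos : 0 < 1 - 2 * u := by linarith
  rw [inv_le_comm₀ (Real.sqrt_pos.2 hpos) (Real.exp_pos _), ← Real.exp_neg]
  apply Real.le_sqrt_of_sq_le
  rw [← Real.exp_nat_mul]
  convert! key using 2
  push_cast
  ring

/-! ### Concentration of convex combinations of squared normals -/

section WeightedSquares

variable {Ω ι : Type*} [MeasurableSpace Ω] {μ : Measure Ω} {G : ι → Ω → ℝ} {c : ι → ℝ} {m : ℝ}

lemma memLp_mul_sq {X : Ω → ℝ} (hX : HasLaw X (gaussianReal 0 1) μ) (r : ℝ) :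
    MemLp (fun ω => r * X ω ^ 2) 2 μ := by
  have h := memLp_sq_gaussianReal
  rw [← hX.map_eq, memLp_map_measure_iff (by fun_prop) hX.aemeasurable] at h
  exact h.const_mul r

lemma integral_mul_sq {X : Ω → ℝ} (hX : HasLaw X (gaussianReal 0 1) μ) (r : ℝ) :
    ∫ ω, r * X ω ^ 2 ∂μ = r := by
  have h := hX.integral_comp (f := fun x : ℝ => x ^ 2) (by fun_prop)
  rw [integral_sq_gaussianReal] at h
  rw [integral_const_mul]
  simp only [Function.comp_def] at h
  rw [h, mul_one]

lemma variance_mul_sq {X : Ω → ℝ} (hX : HasLaw X (gaussianReal 0 1) μ) (r : ℝ) :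
    Var[fun ω => r * X ω ^ 2; μ] = 2 * r ^ 2 := by
  have h := variance_sq_gaussianReal
  rw [← hX.map_eq, variance_map (by fun_prop) hX.aemeasurable] at h
  rw [variance_const_mul]
  simp only [Function.comp_def] at h
  rw [h, mul_comm]

lemma iIndepFun_mul_sq (hG : iIndepFun G μ) (c : ι → ℝ) :
    iIndepFun (fun i ω => c i * G i ω ^ 2) μ :=
  hG.comp (fun i x => c i * x ^ 2) fun i => by fun_prop

/-- A non-integrable exponential would have integral `0` by convention. -/
lemma integrable_exp_mul_of_mgf_pos {X : Ω → ℝ} {t : ℝ} (h : 0 < mgf X μ t) :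
    Integrable (fun ω => Real.exp (t * X ω)) μ := by
  by_contra hn
  rw [mgf, integral_undef hn] at h
  exact lt_irrefl _ h

variable [Fintype ι]

lemma memLp_sum_mul_sq (hlaw : ∀ i, HasLaw (G i) (gaussianReal 0 1) μ) (c : ι → ℝ) :
    MemLp (fun ω => ∑ i, c i * G i ω ^ 2) 2 μ :=
  memLp_finsetSum _ fun i _ => memLp_mul_sq (hlaw i) (c i)

lemma sum_sq_le_of_le_inv (hc0 : ∀ i, 0 ≤ c i) (hc1 : ∑ i, c i = 1) (hcm : ∀ i, c i ≤ 1 / m) :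
    ∑ i, c i ^ 2 ≤ 1 / m :=
  calc ∑ i, c i ^ 2 ≤ ∑ i, 1 / m * c i := Finset.sum_le_sum fun i _ => by
        rw [pow_two]
        exact mul_le_mul_of_nonneg_right (hcm i) (hc0 i)
    _ = 1 / m := by rw [← Finset.mul_sum, hc1, mul_one]

/-- Mean deviation of a convex combination of squares of independent standard normals. -/
lemma integral_abs_sum_mul_sq_sub_one_le [IsProbabilityMeasure μ]
    (hG : iIndepFun G μ)
    (hlaw : ∀ i, HasLaw (G i) (gaussianReal 0 1) μ) (hc0 : ∀ i, 0 ≤ c i) (hc1 : ∑ i, c i = 1)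
    (hcm : ∀ i, c i ≤ 1 / m) :
    ∫ ω, |∑ i, c i * G i ω ^ 2 - 1| ∂μ ≤ √(2 / m) := by
  set Z : Ω → ℝ := fun ω => ∑ i, c i * G i ω ^ 2 with hZ
  have hZL : MemLp Z 2 μ := memLp_sum_mul_sq hlaw c
  have hmean : ∫ ω, Z ω ∂μ = 1 := by
    rw [hZ, integral_finsetSum _ fun i _ =>
      (memLp_mul_sq (hlaw i) (c i)).integrable (by norm_num)]
    simp_rw [integral_mul_sq (hlaw _), hc1]
  have hvar : Var[Z; μ] ≤ 2 / m := by
    have h := IndepFun.variance_sum (s := Finset.univ) (X := fun i ω => c i * G i ω ^ 2)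
      (fun i _ => memLp_mul_sq (hlaw i) (c i))
      fun i _ j _ hij => (iIndepFun_mul_sq hG c).indepFun hij
    have e : (∑ i, fun ω => c i * G i ω ^ 2) = Z := by
      ext ω
      simp [hZ]
    rw [e] at h
    rw [h]
    simp_rw [variance_mul_sq (hlaw _)]
    rw [← Finset.mul_sum]
    have := sum_sq_le_of_le_inv hc0 hc1 hcm
    rw [div_eq_mul_one_div]
    linarith
  have hD : MemLp (fun ω => Z ω - 1) 2 μ := hZL.sub (memLp_const 1)
  have h1 : Var[Z; μ] = ∫ ω, (Z ω - 1) ^ 2 ∂μ := by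
    rw [variance_eq_integral hZL.aemeasurable, hmean]
  -- Nonnegative variance of `|Z - 1|` is the inequality `(E|Z - 1|) ^ 2 ≤ E (Z - 1) ^ 2`.
  have h2 := variance_nonneg (fun ω => |Z ω - 1|) μ
  rw [variance_eq_sub (X := fun ω => |Z ω - 1|) hD.abs] at h2
  simp only [Pi.pow_apply, sq_abs] at h2
  apply Real.le_sqrt_of_sq_le
  linarith

lemma mgf_sum_mul_sq (hG : iIndepFun G μ) (hlaw : ∀ i, HasLaw (G i) (gaussianReal 0 1) μ)
    (c : ι → ℝ) {t : ℝ} (ht : ∀ i, t * c i < 1 / 2) :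
    mgf (fun ω => ∑ i, c i * G i ω ^ 2) μ t = ∏ i, (√(1 - 2 * (t * c i)))⁻¹ := by
  have hm : ∀ i, AEMeasurable (fun ω => c i * G i ω ^ 2) μ := fun i =>
    (memLp_mul_sq (hlaw i) (c i)).aemeasurable
  have h := (iIndepFun_mul_sq hG c).mgf_sum₀ (t := t) hm Finset.univ
  have e : (∑ i, fun ω => c i * G i ω ^ 2) = fun ω => ∑ i, c i * G i ω ^ 2 := by
    ext ω
    simp
  rw [e] at h
  rw [h]
  refine Finset.prod_congr rfl fun i _ => ?_
  rw [mgf_const_mul, mul_comm (c i), ← (mgf_sq_gaussianReal (ht i)).2, ← (hlaw i).map_eq,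
    mgf_map (hlaw i).aemeasurable (by fun_prop)]
  rfl

/-- The weight bound puts every `t * c i` in `[-1/4, 1/4]`, so each factor is at most `exp(u + 2u ^
2)` with `u = t * c i`; the quadratic terms then add up through `∑ c i ^ 2 ≤ 1 / m`. -/
lemma mgf_sum_mul_sq_le (hG : iIndepFun G μ) (hlaw : ∀ i, HasLaw (G i) (gaussianReal 0 1) μ)
    (hc0 : ∀ i, 0 ≤ c i) (hc1 : ∑ i, c i = 1) (hcm : ∀ i, c i ≤ 1 / m) (hm : 0 < m) {t : ℝ}
    (ht : |t| ≤ m / 4) :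
    Integrable (fun ω => Real.exp (t * ∑ i, c i * G i ω ^ 2)) μ ∧
    mgf (fun ω => ∑ i, c i * G i ω ^ 2) μ t ≤ Real.exp (t + 2 * t ^ 2 / m) := by
  have hu : ∀ i, |t * c i| ≤ 1 / 4 := fun i => by
    rw [abs_mul, abs_of_nonneg (hc0 i)]
    calc |t| * c i ≤ m / 4 * (1 / m) := mul_le_mul ht (hcm i) (hc0 i) (by positivity)
      _ = 1 / 4 := by field_simp
  have hlt : ∀ i, t * c i < 1 / 2 := fun i => by linarith [(abs_le.1 (hu i)).2]
  have h := mgf_sum_mul_sq hG hlaw c hlt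
  constructor
  · apply integrable_exp_mul_of_mgf_pos
    rw [h]
    refine Finset.prod_pos fun i _ => inv_pos.2 (Real.sqrt_pos.2 ?_)
    linarith [hlt i]
  · rw [h]
    calc ∏ i, (√(1 - 2 * (t * c i)))⁻¹ ≤ ∏ i, Real.exp (t * c i + 2 * (t * c i) ^ 2) :=
          Finset.prod_le_prod (fun i _ => by positivity) fun i _ => inv_sqrt_one_sub_le_exp (hu i)
      _ = Real.exp (t + 2 * t ^ 2 * ∑ i, c i ^ 2) := by
          rw [← Real.exp_sum, Finset.sum_add_distrib, ← Finset.mul_sum, hc1, Finset.mul_sum, mul_one]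
          congr 2
          exact Finset.sum_congr rfl fun i _ => by ring
      _ ≤ Real.exp (t + 2 * t ^ 2 / m) := by
          have := sum_sq_le_of_le_inv hc0 hc1 hcm
          rw [div_eq_mul_one_div (2 * t ^ 2)]
          gcongr

/-- Two-sided Chernoff bound for a convex combination of squares of independent standard
normals. -/
lemma measureReal_le_abs_sum_mul_sq_sub_one_le [IsProbabilityMeasure μ]
    (hG : iIndepFun G μ)
    (hlaw : ∀ i, HasLaw (G i) (gaussianReal 0 1) μ) (hc0 : ∀ i, 0 ≤ c i) (hc1 : ∑ i, c i = 1)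
    (hcm : ∀ i, c i ≤ 1 / m) (hm : 0 < m) {η : ℝ} (hη0 : 0 ≤ η) (hη1 : η ≤ 1) :
    μ.real {ω | η ≤ |∑ i, c i * G i ω ^ 2 - 1|} ≤ 2 * Real.exp (-(m * η ^ 2 / 8)) := by
  -- Minimizer of the Chernoff exponent `-t * η + 2 * t ^ 2 / m`; it is admissible because `η ≤ 1`.
  set t := η * m / 4 with ht
  have ht0 : 0 ≤ t := by positivity
  have htm : |t| ≤ m / 4 := by
    rw [abs_of_nonneg ht0, ht]
    nlinarith
  obtain ⟨i1, b1⟩ := mgf_sum_mul_sq_le hG hlaw hc0 hc1 hcm hm htm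
  obtain ⟨i2, b2⟩ := mgf_sum_mul_sq_le hG hlaw hc0 hc1 hcm hm (t := -t) (by rwa [abs_neg])
  have u1 := (measure_ge_le_exp_mul_mgf (1 + η) ht0 i1).trans
    (mul_le_mul_of_nonneg_left b1 (Real.exp_nonneg _))
  have u2 := (measure_le_le_exp_mul_mgf (1 - η) (neg_nonpos.2 ht0) i2).trans
    (mul_le_mul_of_nonneg_left b2 (Real.exp_nonneg _))
  rw [← Real.exp_add] at u1 u2
  have e1 : -t * (1 + η) + (t + 2 * t ^ 2 / m) = -(m * η ^ 2 / 8) := by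
    rw [ht]
    field_simp
    ring
  have e2 : -(-t) * (1 - η) + (-t + 2 * (-t) ^ 2 / m) = -(m * η ^ 2 / 8) := by
    rw [ht]
    field_simp
    ring
  rw [e1] at u1
  rw [e2] at u2
  calc μ.real {ω | η ≤ |∑ i, c i * G i ω ^ 2 - 1|}
      ≤ μ.real ({ω | 1 + η ≤ ∑ i, c i * G i ω ^ 2} ∪ {ω | ∑ i, c i * G i ω ^ 2 ≤ 1 - η}) := by
        refine measureReal_mono fun ω hω => ?_
        rcases le_abs.1 (Set.mem_ofPred.1 hω) with h | h
        · exact Or.inl (by simp only [Set.mem_ofPred_eq]; linarith)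
        · exact Or.inr (by simp only [Set.mem_ofPred_eq]; linarith)
    _ ≤ _ := measureReal_union_le _ _
    _ ≤ _ := by linarith

end WeightedSquares

/-! ### Assembling the estimator bounds -/

/-- For an exponent in `(0, 1]`, `u ^ r` lies between `u` and `1`. -/
lemma abs_rpow_sub_one_le {u r : ℝ} (hu : 0 ≤ u) (hr0 : 0 < r) (hr1 : r ≤ 1) :
    |u ^ r - 1| ≤ |u - 1| := by
  rcases le_total u 1 with h | h
  · have h1 : u ^ r ≤ 1 := Real.rpow_le_one hu h hr0.le
    have h2 : u ≤ u ^ r := by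
      rcases hu.eq_or_lt with rfl | hu
      · rw [Real.zero_rpow hr0.ne']
      · simpa using Real.rpow_le_rpow_of_exponent_ge hu h hr1
    rw [abs_of_nonpos (by linarith), abs_of_nonpos (by linarith)]
    linarith
  · have h1 : 1 ≤ u ^ r := Real.one_le_rpow h hr0.le
    have h2 : u ^ r ≤ u := by simpa using Real.rpow_le_rpow_of_exponent_le h hr1
    rw [abs_of_nonneg (by linarith), abs_of_nonneg (by linarith)]
    linarith

/-- The estimator is the `1 / p`-th power of the trace of `φ_N(A)` times a convex combination of
squares of independent standard normals with small weights. -/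
lemma exists_chebyshevMonteCarlo_eq {Ω : Type*} [MeasurableSpace Ω] {μ : Measure Ω}
    [IsProbabilityMeasure μ] {n : ℕ} {A : Matrix (Fin n) (Fin n) ℝ} (hA : A.IsHermitian)
    (a b p : ℝ) (N : ℕ) {M : ℕ} (hM : 1 ≤ M) {w : Fin M → Ω → Fin n → ℝ}
    (hw_indep : iIndepFun (fun (e : Fin M × Fin n) (ω : Ω) => w e.1 ω e.2) μ)
    (hw_law : ∀ (j : Fin M) (i : Fin n), HasLaw (fun ω => w j ω i) (gaussianReal 0 1) μ)
    (hS : 0 < ∑ i, (psiPoly a b p N).eval (hA.eigenvalues i) ^ 2) :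
    ∃ (G : Fin M × Fin n → Ω → ℝ) (c : Fin M × Fin n → ℝ), iIndepFun G μ ∧
      (∀ e, HasLaw (G e) (gaussianReal 0 1) μ) ∧ (∀ e, 0 ≤ c e) ∧ ∑ e, c e = 1 ∧
      (∀ e, c e ≤ 1 / (M : ℝ)) ∧
      ∀ ω, chebyshevMonteCarlo a b p N A (fun j => w j ω) =
        ((∑ i, (psiPoly a b p N).eval (hA.eigenvalues i) ^ 2) * ∑ e, c e * G e ω ^ 2) ^ (1 / p) := by
  set s : Fin n → ℝ := fun i => (psiPoly a b p N).eval (hA.eigenvalues i) ^ 2 with hs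
  have hs0 : ∀ i, 0 ≤ s i := fun i => sq_nonneg _
  set S := ∑ i, s i with hSdef
  have hM0 : (0 : ℝ) < M := by exact_mod_cast hM
  set U := (hA.eigenvectorUnitary : Matrix (Fin n) (Fin n) ℝ) with hU
  have hUt : U.transpose ∈ unitary (Matrix (Fin n) (Fin n) ℝ) := by
    have := Unitary.star_mem hA.eigenvectorUnitary.2
    rwa [Matrix.star_eq_conjTranspose, Matrix.conjTranspose_eq_transpose_of_trivial] at this
  -- The Kronecker product `1 ⊗ Uᵀ` rotates all `M` sample vectors at once, so joint independence of
  -- the `M * n` new coordinates comes from a single orthogonal map.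
  obtain ⟨hG, hlaw⟩ := iIndepFun_hasLaw_mulVec hw_indep (fun e => hw_law e.1 e.2)
    (Matrix.kronecker_mem_unitary (one_mem (unitary (Matrix (Fin M) (Fin M) ℝ))) hUt)
  refine ⟨_, fun e => s e.2 / (S * M), hG, hlaw, fun e => by have := hs0 e.2; positivity, ?_, ?_, ?_⟩
  · rw [Fintype.sum_prod_type]
    simp only [← Finset.sum_div, Finset.sum_const, Finset.card_univ, Fintype.card_fin, nsmul_eq_mul]
    rw [← hSdef]
    field_simp
  · intro e
    rw [div_le_div_iff₀ (by positivity) hM0, one_mul]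
    exact mul_le_mul_of_nonneg_right
      (Finset.single_le_sum (fun i _ => hs0 i) (Finset.mem_univ e.2)) hM0.le
  · intro ω
    have hkron : ∀ (j : Fin M) (i : Fin n),
        (Matrix.kroneckerMap (fun x y => x * y) (1 : Matrix (Fin M) (Fin M) ℝ) U.transpose).mulVec
          (fun e => w e.1 ω e.2) (j, i) = U.transpose.mulVec (w j ω) i := by
      intro j i
      simp [Matrix.mulVec, dotProduct, Fintype.sum_prod_type, Matrix.one_apply]
    rw [chebyshevMonteCarlo]
    congr 1
    simp_rw [dotProduct_phiMatrix_mulVec hA, Fintype.sum_prod_type, hkron, Finset.mul_sum]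
    refine Finset.sum_congr rfl fun j _ => Finset.sum_congr rfl fun i _ => ?_
    simp only [hs, ← hU]
    field_simp

lemma chebyshevMonteCarlo_fin_zero {M : ℕ} (a b : ℝ) {p : ℝ} (hp : p ≠ 0) (N : ℕ)
    (A : Matrix (Fin 0) (Fin 0) ℝ) (w : Fin M → Fin 0 → ℝ) :
    chebyshevMonteCarlo a b p N A w = 0 := by
  simp [chebyshevMonteCarlo, dotProduct, hp]

lemma schattenNorm_fin_zero {p : ℝ} (hp : p ≠ 0) (A : Matrix (Fin 0) (Fin 0) ℝ) :
    schattenNorm p A = 0 := by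
  simp [schattenNorm, hp]

theorem mainTheorem2 {Ω : Type*} [MeasurableSpace Ω] (μ : Measure Ω) [IsProbabilityMeasure μ]
    {n : ℕ} (A : Matrix (Fin n) (Fin n) ℝ) (hA : A.PosDef)
    (a b : ℝ) (ha : 0 < a) (hab : a < b) (hspec : spectrum ℝ A ⊆ Set.Icc a b)
    (p : ℝ) (hp : 1 ≤ p) (ε : ℝ) (hε : 0 < ε) (hε1 : ε ≤ 1)
    (N : ℕ) (hN : chebyshevDegreeBound a b p ε ≤ (N : ℝ))
    (M : ℕ) (hM : 1 ≤ M) (w : Fin M → Ω → Fin n → ℝ)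
    (hw_indep : iIndepFun (fun (e : Fin M × Fin n) (ω : Ω) => w e.1 ω e.2) μ)
    (hw_law : ∀ (j : Fin M) (i : Fin n), HasLaw (fun ω => w j ω i) (gaussianReal 0 1) μ) :
    (Integrable (fun ω => chebyshevMonteCarlo a b p N A (fun j => w j ω)) μ ∧
      |(∫ ω, chebyshevMonteCarlo a b p N A (fun j => w j ω) ∂μ) - schattenNorm p A| ≤
        (1 + ε / 2) * schattenNorm p A * (2 / (M : ℝ)) ^ (1 / 2 : ℝ) +
          ε / 2 * schattenNorm p A) ∧
    ∀ δ : ℝ, 0 < δ → δ < 1 → 72 * ε⁻¹ ^ 2 * Real.log (2 / δ) ≤ (M : ℝ) →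
      IsEpsDeltaEstimator μ ε δ
        (fun ω => chebyshevMonteCarlo a b p N A (fun j => w j ω)) (schattenNorm p A) := by
  have hp0 : 0 < p := by linarith
  -- For `n = 0` the estimator and the norm both vanish; otherwise `T > 0` and one may divide by it.
  rcases n.eq_zero_or_pos with rfl | hn
  · simp only [chebyshevMonteCarlo_fin_zero a b hp0.ne', schattenNorm_fin_zero hp0.ne']
    refine ⟨⟨integrable_const _, by simp⟩, fun δ hδ _ _ => ?_⟩
    simp [IsEpsDeltaEstimator, hδ.le]
  have hr0 : 0 < 1 / p := by positivity
  have hr1 : 1 / p ≤ 1 := by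
    rw [div_le_one hp0]
    exact hp
  have hH := hA.isHermitian
  have hlam : ∀ i, hH.eigenvalues i ∈ Set.Icc a b := fun i =>
    hspec (hH.eigenvalues_mem_spectrum_real i)
  have hlampos : ∀ i, 0 < hH.eigenvalues i ^ p := fun i =>
    Real.rpow_pos_of_pos (ha.trans_le (hlam i).1) _
  set T := ∑ i, hH.eigenvalues i ^ p with hT
  set S := ∑ i, (psiPoly a b p N).eval (hH.eigenvalues i) ^ 2 with hS
  have : Nonempty (Fin n) := ⟨⟨0, hn⟩⟩
  have hT0 : 0 < T := Finset.sum_pos (fun i _ => hlampos i) Finset.univ_nonempty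
  have hST : |S - T| ≤ ε / 2 * T := by
    rw [hS, hT, ← Finset.sum_sub_distrib, Finset.mul_sum]
    exact (Finset.abs_sum_le_sum_abs _ _).trans
      (Finset.sum_le_sum fun i _ => abs_sq_eval_psiPoly_sub_le ha hab hp0 hε hε1 hN (hlam i))
  set s := S / T with hs
  have hSs : S = T * s := by
    rw [hs]
    field_simp
  have hs1 : |s - 1| ≤ ε / 2 := by
    rw [hs, div_sub_one hT0.ne', abs_div, abs_of_pos hT0, div_le_iff₀ hT0]
    exact hST
  obtain ⟨hsl, hsu⟩ := abs_le.1 hs1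
  have hs0 : 0 < s := by linarith
  have hS0 : 0 < S := by
    rw [hSs]
    positivity
  have hnorm : schattenNorm p A = T ^ (1 / p) := schattenNorm_eq_sum_eigenvalues hA p
  set L := T ^ (1 / p) with hL
  have hL0 : 0 < L := Real.rpow_pos_of_pos hT0 _
  obtain ⟨G, c, hG, hlaw, hc0, hc1, hcm, hY⟩ :=
    exists_chebyshevMonteCarlo_eq hH a b p N hM hw_indep hw_law hS0
  have hM0 : (0 : ℝ) < M := by exact_mod_cast hM
  rw [hnorm]
  simp only [hY]
  set Z : Ω → ℝ := fun ω => ∑ e, c e * G e ω ^ 2 with hZ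
  change (Integrable (fun ω => (S * Z ω) ^ (1 / p)) μ ∧
      |(∫ ω, (S * Z ω) ^ (1 / p) ∂μ) - L| ≤ _) ∧
    ∀ δ : ℝ, _ → _ → _ → IsEpsDeltaEstimator μ ε δ (fun ω => (S * Z ω) ^ (1 / p)) L
  have hZ0 : ∀ ω, 0 ≤ Z ω := fun ω =>
    Finset.sum_nonneg fun e _ => mul_nonneg (hc0 e) (sq_nonneg _)
  have hZL : MemLp Z 2 μ := memLp_sum_mul_sq hlaw c
  have hZi : Integrable Z μ := hZL.integrable (by norm_num)
  refine ⟨?_, fun δ hδ0 hδ1 hMδ => ?_⟩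
  · set R := S ^ (1 / p) with hR
    have hR0 : 0 < R := Real.rpow_pos_of_pos hS0 _
    have hRL : R = L * s ^ (1 / p) := by rw [hR, hL, hSs, Real.mul_rpow hT0.le hs0.le]
    have hsr : |s ^ (1 / p) - 1| ≤ ε / 2 := (abs_rpow_sub_one_le hs0.le hr0 hr1).trans hs1
    have hRL1 : |R - L| ≤ ε / 2 * L := by
      rw [hRL, show L * s ^ (1 / p) - L = L * (s ^ (1 / p) - 1) by ring, abs_mul, abs_of_pos hL0,
        mul_comm]
      gcongr
    have hRL2 : R ≤ (1 + ε / 2) * L := by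
      have := (abs_le.1 hRL1).2
      linarith
    have hpt : ∀ ω, |(S * Z ω) ^ (1 / p) - R| ≤ R * |Z ω - 1| := fun ω => by
      rw [Real.mul_rpow hS0.le (hZ0 ω), ← hR,
        show R * Z ω ^ (1 / p) - R = R * (Z ω ^ (1 / p) - 1) by ring, abs_mul, abs_of_pos hR0]
      exact mul_le_mul_of_nonneg_left (abs_rpow_sub_one_le (hZ0 ω) hr0 hr1) hR0.le
    have hdom : Integrable (fun ω => R * |Z ω - 1|) μ :=
      ((hZi.sub (integrable_const 1)).abs).const_mul R
    have hmeas : AEStronglyMeasurable (fun ω => (S * Z ω) ^ (1 / p)) μ :=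
      ((hZi.aemeasurable.const_mul S).pow_const (1 / p)).aestronglyMeasurable
    have hdiff : Integrable (fun ω => (S * Z ω) ^ (1 / p) - R) μ :=
      hdom.mono' (hmeas.sub aestronglyMeasurable_const) (Filter.Eventually.of_forall hpt)
    have hint : Integrable (fun ω => (S * Z ω) ^ (1 / p)) μ := by
      refine (hdiff.add (integrable_const R)).congr (Filter.Eventually.of_forall fun ω => ?_)
      exact sub_add_cancel _ R
    refine ⟨hint, ?_⟩
    have h1 : |(∫ ω, (S * Z ω) ^ (1 / p) ∂μ) - R| ≤ R * √(2 / M) := by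
      have e : (∫ ω, (S * Z ω) ^ (1 / p) ∂μ) - R = ∫ ω, ((S * Z ω) ^ (1 / p) - R) ∂μ := by
        rw [integral_sub hint (integrable_const _)]
        simp
      rw [e, ← Real.norm_eq_abs]
      calc _ ≤ ∫ ω, R * |Z ω - 1| ∂μ :=
            norm_integral_le_of_norm_le hdom (Filter.Eventually.of_forall hpt)
        _ = R * ∫ ω, |Z ω - 1| ∂μ := integral_const_mul _ _
        _ ≤ _ := mul_le_mul_of_nonneg_left
          (integral_abs_sum_mul_sq_sub_one_le hG hlaw hc0 hc1 hcm) hR0.le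
    rw [← Real.sqrt_eq_rpow]
    calc _ ≤ |(∫ ω, (S * Z ω) ^ (1 / p) ∂μ) - R| + |R - L| := abs_sub_le _ _ _
      _ ≤ R * √(2 / M) + ε / 2 * L := add_le_add h1 hRL1
      _ ≤ _ := by gcongr
  -- The choice `η = ε / 3` yields `72 = 9 * 8`, and `(1 + ε / 2) * (1 + ε / 3) ≤ 1 + ε` since `ε ≤
  -- 1`.
  · have htail := measureReal_le_abs_sum_mul_sq_sub_one_le hG hlaw hc0 hc1 hcm hM0
      (η := ε / 3) (by positivity) (by linarith)
    have hexp : 2 * Real.exp (-(M * (ε / 3) ^ 2 / 8)) ≤ δ := by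
      have h1 : Real.log (2 / δ) ≤ M * (ε / 3) ^ 2 / 8 := by
        have h2 : M * (ε / 3) ^ 2 / 8 = M * (ε ^ 2 / 72) := by ring
        rw [h2]
        calc Real.log (2 / δ) = 72 * ε⁻¹ ^ 2 * Real.log (2 / δ) * (ε ^ 2 / 72) := by field_simp
          _ ≤ _ := by gcongr
      calc 2 * Real.exp (-(M * (ε / 3) ^ 2 / 8)) ≤ 2 * Real.exp (-Real.log (2 / δ)) := by gcongr
        _ = δ := by
          rw [Real.exp_neg, Real.exp_log (by positivity)]
          field_simp
    have hgood : ∀ ω, |Z ω - 1| < ε / 3 → |(S * Z ω) ^ (1 / p) - L| ≤ ε * |L| := fun ω hω => by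
      obtain ⟨h1, h2⟩ := abs_lt.1 hω
      have hsz : |s * Z ω - 1| ≤ ε := by
        rw [abs_le]
        constructor <;> nlinarith
      rw [hSs, mul_assoc, Real.mul_rpow hT0.le (mul_nonneg hs0.le (hZ0 ω)), ← hL,
        show L * (s * Z ω) ^ (1 / p) - L = ((s * Z ω) ^ (1 / p) - 1) * L by ring, abs_mul]
      exact mul_le_mul_of_nonneg_right
        ((abs_rpow_sub_one_le (mul_nonneg hs0.le (hZ0 ω)) hr0 hr1).trans hsz) (abs_nonneg _)
    -- Subadditivity over a cover replaces passing to complements, so no measurability of the events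
    -- is needed.
    have hcover : (1 : ℝ) ≤ μ.real {ω | |(S * Z ω) ^ (1 / p) - L| ≤ ε * |L|} +
        μ.real {ω | ε / 3 ≤ |Z ω - 1|} := by
      refine le_trans ?_ (measureReal_union_le _ _)
      refine (probReal_univ (μ := μ)).ge.trans (measureReal_mono fun ω _ => ?_)
      rcases lt_or_ge |Z ω - 1| (ε / 3) with h | h
      · exact Or.inl (hgood ω h)
      · exact Or.inr h
    rw [IsEpsDeltaEstimator]
    linarith
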